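/- Let $d,d_Y,d_Z,D,d_g\ge 1$ be integers, $\beta,\gamma\ge 1$, $K>0$, $F\ge 1$. Let $X,Y,Z$ be random vectors on a probability space $(\Omega,\mathcal A,\mathbb P)$ with values almost surely in $[0,1]^d$, $[0,1]^{d_Y}$, $[0,1]^{d_Z}$, with $Z$ independent of $Y$. *Generators.* For an integer $r\ge1$ and real $\beta\ge1$, $C^\beta([0,1]^r,K)$ is the set of functions $f$ that are continuously differentiable of every order smaller than $\beta$ on $[0,1]^r$ and satisfy $\sum_{0\le|\alpha|<\beta}\|\partial^\alpha f\|_\infty+\sum_{|\alpha|=\beta-1}\sup_{x\ne y}\frac{|\partial^\alpha f(x)-\partial^\alpha f(y)|}{|x-y|_\infty}\le K$. Let $\mathcal G^c=\mathcal G^c(d_Z,d_Y,D,d_g,\beta,K)$ be the set of measurable $g:\mathbb R^{d_Z+d_Y}\to\mathbb R^d$ of the form $g=g_{dec}\circ g_{enc,1}\circ g_{enc,0}$, where every component of $g_{enc,0}:\mathbb R^{d_Z+d_Y}\to\mathbb R^D$ depends on only $d_g$ of the arguments, through a function in $C^\beta([0,1]^{d_g},K)$; every component of $g_{enc,1}:\mathbb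 R^D\to\mathbb R^{d_g}$ lies in $C^{\tilde\beta}([0,1]^D,K)$ for some $\tilde\beta\ge1$ with $\tilde\beta\ge\frac{D}{d_g}\beta$; and every component of $g_{dec}:\mathbb R^{d_g}\to\mathbb R^d$ lies in $C^\beta([0,1]^{d_g},K)$. Suppose that $\mathbb P^{X,Y}=\mathbb P^{g^*(Z,Y),Y}$ for some $g^*\in\mathcal G^c$. *Critics.* For $L\in\mathbb N_0$, $\mathbf p=(p_0,\dots,p_{L+1})$ and $s\in\mathbb N_0$, let $\mathcal R(L,\mathbf p,s)$ be the set of functions $h:\mathbb R^{p_0}\to\mathbb R^{p_{L+1}}$, $h(x)=W^{(L)}\sigma_{v^{(L)}}W^{(L-1)}\cdots W^{(1)}\sigma_{v^{(1)}}W^{(0)}x$ with $\sigma_v(y)=\max(y-v,0)$ componentwise, where all entries of the matrices $W^{(l)}$ and the vectors $v^{(l)}$ are at most $1$ in absolute value, at most $s$ of them are nonzero, and $|h|_\infty\le F$ on $[0,1]^{p_0}$. For each $n$ let $L_n$, $\mathbf p_n$ (with $p_{n,0}=d+d_Y$, $p_{n,L_n+1}=1$) and $s_n$ be given, and put $$W^c_{1,n}(g)=\sup\big\{\mathbb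 E f(X,Y)-\mathbb E f(g(Z,Y),Y)\ :\ f\in\mathcal R(L_n,\mathbf p_n,s_n),\ \|f\|_L\le1\big\},$$ where $\|f\|_L$ is the Lipschitz constant on $\mathbb R^{d+d_Y}$ with respect to the Euclidean norm. Let $a_n=n^{-2\gamma/(2\gamma+d)}$ and suppose that, for some constant $c>0$ and all sufficiently large $n$, $$L_n\ge\log_2(n)\log_2(4d\vee4\gamma),\qquad \min_{1\le i\le L_n}p_{n,i}\ge c\,n a_n,\qquad s_n\ge c\log(n)\,n a_n,$$ and that $L_n=o(s_n)$ (which holds, for instance, if $L_n=O(\log n)$). *Random generators.* For each $n$ let $\hat g^c_n$ be a random function $\mathbb R^{d_Z+d_Y}\to\mathbb R^d$ such that $(\omega,u)\mapsto\hat g^c_n(\omega)(u)$ is measurable with respect to $\mathcal T_n\otimes\mathcal B(\mathbb R^{d_Z+d_Y})$ for some $\sigma$-algebra $\mathcal T_n\subset\mathcal A$ independent of $(Z,Y)$, and such that for almost every $\omega$ the vector $\hat g^c_n(\omega)(Z,Y)$ is integrable. If $\mathbb E\,W^c_{1,n}(\hat g^c_n)\to0$, then $$(\hat g^c_n(Z,Y),Y)\overset{d}{\to}(X,Y),\qquad\text{in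 particular}\qquad \hat g^c_n(Z,Y)\overset{d}{\to}X.$$ Moreover $\mathbb P^{\hat g^c_n(Z,y)}$ converges to the conditional law $\mathbb P^{X|Y=y}$ in the following sense averaged over $y$: for every bounded continuous $h:\mathbb R^d\to\mathbb R$ and every $\varphi\in L^1(\mathbb P^Y)$, $$\int\varphi(y)\,\mathbb E\,h(\hat g^c_n(Z,y))\,\mathbb P^Y(dy)\ \longrightarrow\ \int\varphi(y)\int h(x)\,\mathbb P^{X|Y=y}(dx)\,\mathbb P^Y(dy).$$ -/

import Mathlib

open MeasureTheory ProbabilityTheory Filter Topology Asymptotics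
open scoped ENNReal NNReal BoundedContinuousFunction

namespace WGAN

noncomputable section

/-- The unit cube `[0,1]^r`. -/
def unitCube (r : ℕ) : Set (Fin r → ℝ) := Set.Icc 0 1

/-! ### Hölder classes -/

/-- The partial derivative `∂ᵢ f` of a function on the unit cube (one-sided at the boundary). -/
def partialDeriv {r : ℕ} (i : Fin r) (f : (Fin r → ℝ) → ℝ) : (Fin r → ℝ) → ℝ :=
  fun x => fderivWithin ℝ f (unitCube r) x (Pi.single i 1)

/-- `∂^α f = ∂₁^{α₁} ⋯ ∂ᵣ^{αᵣ} f` on the unit cube. -/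
def multiDeriv {r : ℕ} (α : Fin r → ℕ) (f : (Fin r → ℝ) → ℝ) : (Fin r → ℝ) → ℝ :=
  (List.finRange r).foldr (fun i h => (partialDeriv i)^[α i] h) f

/-- The class `C^β([0,1]^r, K)`, `β ≥ 1`: the sum over `|α| < β` of the sup-norms of `∂^α f` plus
the sum over `|α| = β - 1` of the Lipschitz constants of `∂^α f` with respect to `|·|_∞` is at
most `K`. Only the restriction of `f` to the cube matters. Here `⌈β⌉ - 1` is the largest integer
smaller than `β`, so all derivatives that occur exist; `edist` on `Fin r → ℝ` is the
`|·|_∞`-distance. -/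
def holderClass (r : ℕ) (β K : ℝ) : Set ((Fin r → ℝ) → ℝ) :=
  {f | ContDiffOn ℝ ((⌈β⌉₊ - 1 : ℕ) : WithTop ℕ∞) f (unitCube r) ∧
    (∑' α : {α : Fin r → ℕ // ((∑ i, α i : ℕ) : ℝ) < β},
        ⨆ x ∈ unitCube r, ‖multiDeriv α.1 f x‖ₑ) +
      (∑' α : {α : Fin r → ℕ // ((∑ i, α i : ℕ) : ℝ) = β - 1},
        ⨆ x ∈ unitCube r, ⨆ y ∈ unitCube r, ⨆ _ : x ≠ y,
          ‖multiDeriv α.1 f x - multiDeriv α.1 f y‖ₑ / edist x y)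
      ≤ ENNReal.ofReal K}

/-- The class `𝒢ᶜ(d_Z, d_Y, D, d_g, β, K)` of measurable generators
`g = g_dec ∘ g_enc,1 ∘ g_enc,0 : ℝ^{d_Z + d_Y} → ℝ^d` with encoder-decoder structure. -/
def encoderDecoderClass (dZ dY d D dg : ℕ) (β K : ℝ) :
    Set ((Fin (dZ + dY) → ℝ) → (Fin d → ℝ)) :=
  {g | Measurable g ∧
    ∃ (enc₀ : (Fin (dZ + dY) → ℝ) → (Fin D → ℝ)) (enc₁ : (Fin D → ℝ) → (Fin dg → ℝ))
      (dec : (Fin dg → ℝ) → (Fin d → ℝ)),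
      (∀ j, ∃ (e : Fin dg ↪ Fin (dZ + dY)), ∃ h ∈ holderClass dg β K,
        ∀ x, enc₀ x j = h (fun i => x (e i))) ∧
      (∃ β' : ℝ, 1 ≤ β' ∧ (D : ℝ) / dg * β ≤ β' ∧
        ∀ j, (fun x => enc₁ x j) ∈ holderClass D β' K) ∧
      (∀ j, (fun x => dec x j) ∈ holderClass dg β K) ∧
      g = dec ∘ enc₁ ∘ enc₀}

/-! ### ReLU networks -/

/-- A network architecture `(L, 𝐩)` with input dimension `p_0 = r` and output dimension
`p_{L+1} = m`; only the entries `p_0, …, p_{L+1}` of `width` matter. -/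
structure Architecture (r m : ℕ) where
  /-- the number `L` of hidden layers -/
  depth : ℕ
  /-- the width vector `𝐩` -/
  width : ℕ → ℕ
  width_zero : width 0 = r
  width_last : width (depth + 1) = m

/-- The vector `W^{(l)} σ_{v^{(l)}} W^{(l-1)} ⋯ W^{(1)} σ_{v^{(1)}} W^{(0)} x`, where
`σ_v(y) = max(y - v, 0)` componentwise. -/
def layerOutput {p : ℕ → ℕ} (W : (l : ℕ) → Matrix (Fin (p (l + 1))) (Fin (p l)) ℝ)
    (v : (l : ℕ) → Fin (p l) → ℝ) (x : Fin (p 0) → ℝ) : (l : ℕ) → Fin (p (l + 1)) → ℝ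
  | 0 => (W 0).mulVec x
  | l + 1 => (W (l + 1)).mulVec (fun i => max (layerOutput W v x l i - v (l + 1) i) 0)

/-- The class `ℛ(L, 𝐩, s, F)` of sparse ReLU networks: all weights and biases bounded by `1` in
absolute value, at most `s` of them nonzero, and the network bounded by `F` on the unit cube.
The weight matrices are `W^{(0)}, …, W^{(L)}`, the bias vectors are `v^{(1)}, …, v^{(L)}`. -/
def sparseNetworks {r m : ℕ} (A : Architecture r m) (s : ℕ) (F : ℝ) :
    Set ((Fin r → ℝ) → (Fin m → ℝ)) :=
  {h | (∃ (W : (l : ℕ) → Matrix (Fin (A.width (l + 1))) (Fin (A.width l)) ℝ)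
        (v : (l : ℕ) → Fin (A.width l) → ℝ),
        (∀ l ≤ A.depth, ∀ i j, |W l i j| ≤ 1) ∧
        (∀ l, 1 ≤ l → l ≤ A.depth → ∀ i, |v l i| ≤ 1) ∧
        (∑ l ∈ Finset.range (A.depth + 1),
            Set.ncard {ij : Fin (A.width (l + 1)) × Fin (A.width l) | W l ij.1 ij.2 ≠ 0}) +
          (∑ l ∈ Finset.Icc 1 A.depth, Set.ncard {i : Fin (A.width l) | v l i ≠ 0}) ≤ s ∧
        ∀ x k, h x k = layerOutput W v (fun i => x (Fin.cast A.width_zero i)) A.depth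
          (Fin.cast A.width_last.symm k)) ∧
    ∀ x ∈ unitCube r, ∀ k, |h x k| ≤ F}

/-- The critics: real-valued networks `f ∈ ℛ(L, 𝐩, s, F)` with `‖f‖_L ≤ 1`, the Lipschitz norm
being taken on `ℝ^r` with respect to the Euclidean norm. -/
def criticClass {r : ℕ} (A : Architecture r 1) (s : ℕ) (F : ℝ) : Set ((Fin r → ℝ) → ℝ) :=
  {f | (fun x (_ : Fin 1) => f x) ∈ sparseNetworks A s F ∧
    LipschitzWith 1 (fun x : EuclideanSpace ℝ (Fin r) => f (WithLp.ofLp x))}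

/-! ### The modified conditional Wasserstein distance -/

/-- `W^c_{1,n}(g) = sup_f {E f(X, Y) - E f(g(Z, Y), Y)}`, the supremum over all critics `f` with the
given architecture, sparsity and bound. -/
def conditionalW {Ω : Type*} [MeasurableSpace Ω] (P : Measure Ω) {d dY dZ : ℕ}
    (X : Ω → Fin d → ℝ) (Y : Ω → Fin dY → ℝ) (Z : Ω → Fin dZ → ℝ)
    (A : Architecture (d + dY) 1) (s : ℕ) (F : ℝ)
    (g : (Fin (dZ + dY) → ℝ) → (Fin d → ℝ)) : EReal :=
  ⨆ f ∈ criticClass A s F,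
    (((∫ ω, f (Fin.append (X ω) (Y ω)) ∂P) -
      ∫ ω, f (Fin.append (g (Fin.append (Z ω) (Y ω))) (Y ω)) ∂P : ℝ) : EReal)

lemma layerOutput_zero {p : ℕ → ℕ} (x : Fin (p 0) → ℝ) (l : ℕ) :
    layerOutput (p := p) (fun _ => 0) (fun _ => 0) x l = 0 := by
  cases l <;> simp [layerOutput]

lemma zero_mem_criticClass {r : ℕ} (A : Architecture r 1) (s : ℕ) {F : ℝ} (hF : 0 ≤ F) :
    (fun _ => 0) ∈ criticClass A s F := by
  refine ⟨⟨⟨fun _ => 0, fun _ => 0, by simp, by simp, by simp, fun x k => ?_⟩, by simp [hF]⟩,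
    LipschitzWith.const' 0⟩
  rw [layerOutput_zero]
  rfl

/-- The supremum is nonnegative, so passing to `ℝ≥0∞` by `EReal.toENNReal` loses nothing. -/
lemma conditionalW_nonneg {Ω : Type*} [MeasurableSpace Ω] (P : Measure Ω) {d dY dZ : ℕ}
    (X : Ω → Fin d → ℝ) (Y : Ω → Fin dY → ℝ) (Z : Ω → Fin dZ → ℝ)
    (A : Architecture (d + dY) 1) (s : ℕ) {F : ℝ} (hF : 0 ≤ F)
    (g : (Fin (dZ + dY) → ℝ) → (Fin d → ℝ)) : 0 ≤ conditionalW P X Y Z A s F g := by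
  refine le_trans ?_ (le_iSup₂ (fun _ => 0) (zero_mem_criticClass A s hF))
  simp

end

end WGAN

/-!
The critic classes are used only through their simplest members. A ridge function
`x ↦ max (θ ⬝ x - v) 0` is a network with a single active neuron; since its value is nonnegative,
the remaining hidden layers can pass it on unchanged at the price of one nonzero weight each.
The growth conditions force `L_n → ∞`, widths `→ ∞`, `s_n → ∞` and `L_n = o(s_n)`, so for every
`θ`, `v` a small multiple of the ridge function and its negative are critics for all large `n`
(`ridge_mem_criticClass`, `eventually_ridge_mem_criticClass`). No approximation theory is needed.

Because both signs are available, `W^c` dominates `|E f(X, Y) - E f(g(Z, Y), Y)|` for such `f`.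
Averaging over the random generator, which is independent of `(Z, Y)`, and rescaling gives
`E f(ĝ_n(Z, Y), Y) → E f(X, Y)` for every ridge function `f` (`tendsto_lintegral_critic`).

Ridge functions determine convergence in distribution when the limit is bounded
(`tendstoInDistribution_of_ridge`): along each direction `θ`, linear combinations of ReLU functions
include the linear interpolants of `cos` and `sin`, and the functions `max (±t - M) 0` control
the tails, so `E cos` and `E sin` of every projection converge
(`TendstoExpectation.of_lipschitz`). Hence the characteristic functions converge and Lévy's
theorem applies.

For the conditional laws, Fubini's theorem identifies both sides of the claim with
`E φ(Y) h(ĝ_n(Z, Y))` and `E φ(Y) h(X)`. Joint weak convergence gives the limit for bounded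
continuous `φ`, and since the law of `Y` does not depend on `n`, density in `L¹` gives it for all
integrable `φ` (`tendsto_integral_mul_of_tendstoInDistribution`).
-/

namespace WGAN

/-! ### Ridge functions as critics -/

/-- The ridge function `x ↦ max (θ ⬝ x - v) 0`, i.e. a single ReLU neuron. -/
def ridge {r : ℕ} (θ : Fin r → ℝ) (v : ℝ) (x : Fin r → ℝ) : ℝ := max (∑ i, θ i * x i - v) 0

lemma ridge_nonneg {r : ℕ} (θ : Fin r → ℝ) (v : ℝ) (x : Fin r → ℝ) : 0 ≤ ridge θ v x :=
  le_max_right _ _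

lemma continuous_ridge {r : ℕ} (θ : Fin r → ℝ) (v : ℝ) : Continuous (ridge θ v) := by
  unfold ridge; fun_prop

lemma ridge_smul {r : ℕ} {ε : ℝ} (hε : 0 ≤ ε) (θ : Fin r → ℝ) (v : ℝ) (x : Fin r → ℝ) :
    ridge (fun i => ε * θ i) (ε * v) x = ε * ridge θ v x := by
  simp only [ridge, mul_max_of_nonneg _ _ hε, mul_sub, Finset.mul_sum, mul_zero, mul_assoc]

lemma abs_sum_mul_le_of_mem_unitCube {r : ℕ} (θ : Fin r → ℝ) {x : Fin r → ℝ}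
    (hx : x ∈ unitCube r) : |∑ i, θ i * x i| ≤ ∑ i, |θ i| := by
  refine (Finset.abs_sum_le_sum_abs _ _).trans (Finset.sum_le_sum fun i _ => ?_)
  have h0 : 0 ≤ x i := hx.1 i
  have h1 : x i ≤ 1 := hx.2 i
  rw [abs_mul, abs_of_nonneg h0]
  exact mul_le_of_le_one_right (abs_nonneg _) h1

lemma ridge_le_of_mem_unitCube {r : ℕ} (θ : Fin r → ℝ) (v : ℝ) {x : Fin r → ℝ}
    (hx : x ∈ unitCube r) : ridge θ v x ≤ (∑ i, |θ i|) + |v| := by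
  have h := abs_le.1 (abs_sum_mul_le_of_mem_unitCube θ hx)
  have hv := neg_abs_le v
  refine max_le (by linarith) (by positivity)

lemma abs_ridge_sub_le {r : ℕ} (θ : Fin r → ℝ) (v : ℝ) (x y : EuclideanSpace ℝ (Fin r)) :
    |ridge θ v x.ofLp - ridge θ v y.ofLp| ≤ (∑ i, |θ i|) * dist x y := by
  refine (abs_max_sub_max_le_abs _ _ _).trans ?_
  rw [sub_sub_sub_cancel_right, ← Finset.sum_sub_distrib, Finset.sum_mul]
  refine (Finset.abs_sum_le_sum_abs _ _).trans (Finset.sum_le_sum fun i _ => ?_)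
  rw [← mul_sub, abs_mul]
  refine mul_le_mul_of_nonneg_left ?_ (abs_nonneg _)
  simpa [dist_eq_norm] using PiLp.norm_apply_le (x - y) i

/-- The weights of a network of depth `L` with one active neuron per layer: the first one computes
`θ ⬝ x`, the following ones pass their (nonnegative) input on, the output is multiplied by `τ`.
The vector `θ` is indexed by `ℕ`, so that no cast between the index types is needed. -/
def ridgeWeight (p : ℕ → ℕ) (L : ℕ) (θ : ℕ → ℝ) (τ : ℝ) (l : ℕ) :
    Matrix (Fin (p (l + 1))) (Fin (p l)) ℝ :=
  fun i j => if i.val = 0 then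
    if l = 0 then θ j else if j.val = 0 then if l = L then τ else 1 else 0 else 0

/-- The biases of the network with weights `ridgeWeight`: only the first active neuron has one. -/
def ridgeBias (p : ℕ → ℕ) (v : ℝ) (l : ℕ) : Fin (p l) → ℝ :=
  fun i => if l = 1 ∧ i.val = 0 then v else 0

lemma layerOutput_ridge_zero (p : ℕ → ℕ) (L : ℕ) (θ : ℕ → ℝ) (τ v : ℝ) (x : Fin (p 0) → ℝ)
    (i : Fin (p 1)) (hi : i.val = 0) :
    layerOutput (ridgeWeight p L θ τ) (ridgeBias p v) x 0 i = ∑ j : Fin (p 0), θ j * x j := by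
  simp [layerOutput, ridgeWeight, Matrix.mulVec, dotProduct, hi]

lemma layerOutput_ridge_succ (p : ℕ → ℕ) (L : ℕ) (θ : ℕ → ℝ) (τ v : ℝ) (x : Fin (p 0) → ℝ)
    (l : ℕ) (hl : l < L) (hp : ∀ k, 1 ≤ k → k ≤ L → 1 ≤ p k)
    (i : Fin (p (l + 1 + 1))) (hi : i.val = 0) :
    layerOutput (ridgeWeight p L θ τ) (ridgeBias p v) x (l + 1) i
      = (if l + 1 = L then τ else 1) * max ((∑ j : Fin (p 0), θ j * x j) - v) 0 := by
  induction l with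
  | zero =>
    have h0 : 0 < p (0 + 1) := hp _ le_rfl (by omega)
    rw [layerOutput, Matrix.mulVec, dotProduct, Finset.sum_eq_single (⟨0, h0⟩ : Fin (p (0 + 1)))]
    · rw [layerOutput_ridge_zero _ _ _ _ _ _ _ rfl]
      simp [ridgeWeight, ridgeBias, hi]
    · intro j _ hj
      have : j.val ≠ 0 := fun h => hj (Fin.ext h)
      simp [ridgeWeight, this]
    · simp
  | succ l ih =>
    have h0 : 0 < p (l + 1 + 1) := hp _ (by omega) (by omega)
    rw [layerOutput, Matrix.mulVec, dotProduct,
      Finset.sum_eq_single (⟨0, h0⟩ : Fin (p (l + 1 + 1)))]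
    · rw [ih (by omega) ⟨0, h0⟩ rfl, if_neg (by omega : ¬ l + 1 = L)]
      simp [ridgeWeight, ridgeBias, hi]
    · intro j _ hj
      have : j.val ≠ 0 := fun h => hj (Fin.ext h)
      simp [ridgeWeight, this]
    · simp

lemma ncard_ridgeWeight_zero_le (p : ℕ → ℕ) (L : ℕ) (θ : ℕ → ℝ) (τ : ℝ) :
    Set.ncard {ij : Fin (p (0 + 1)) × Fin (p 0) | ridgeWeight p L θ τ 0 ij.1 ij.2 ≠ 0} ≤ p 0 := by
  refine (Set.ncard_le_ncard_of_injOn (t := Set.univ) Prod.snd (by simp) ?_).trans ?_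
  · rintro ⟨i, j⟩ hij ⟨i', j'⟩ hij' h
    have hi : i.val = 0 := by by_contra h; simp [ridgeWeight, h] at hij
    have hi' : i'.val = 0 := by by_contra h; simp [ridgeWeight, h] at hij'
    exact Prod.ext (Fin.ext (hi.trans hi'.symm)) h
  · simp [Set.ncard_univ]

lemma ncard_ridgeWeight_succ_le (p : ℕ → ℕ) (L : ℕ) (θ : ℕ → ℝ) (τ : ℝ) (l : ℕ) :
    Set.ncard {ij : Fin (p (l + 1 + 1)) × Fin (p (l + 1)) |
      ridgeWeight p L θ τ (l + 1) ij.1 ij.2 ≠ 0} ≤ 1 := by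
  rw [Set.ncard_le_one]
  rintro ⟨i, j⟩ hij ⟨i', j'⟩ hij'
  have key : ∀ (i : Fin (p (l + 1 + 1))) (j : Fin (p (l + 1))),
      ridgeWeight p L θ τ (l + 1) i j ≠ 0 → i.val = 0 ∧ j.val = 0 := by
    intro i j h
    by_contra hc
    apply h
    simp only [ridgeWeight]
    grind
  have h := key i j hij
  have h' := key i' j' hij'
  exact Prod.ext (Fin.ext (h.1.trans h'.1.symm)) (Fin.ext (h.2.trans h'.2.symm))

lemma ncard_ridgeBias_le (p : ℕ → ℕ) (v : ℝ) (l : ℕ) :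
    Set.ncard {i : Fin (p l) | ridgeBias p v l i ≠ 0} ≤ if l = 1 then 1 else 0 := by
  split_ifs with hl
  · rw [Set.ncard_le_one]
    intro i hi j hj
    have hi' : i.val = 0 := by by_contra h; simp [ridgeBias, h] at hi
    have hj' : j.val = 0 := by by_contra h; simp [ridgeBias, h] at hj
    exact Fin.ext (hi'.trans hj'.symm)
  · simp [ridgeBias, hl]

/-- Every sufficiently small ridge function and its negative are critics, whatever the
architecture, as soon as there is a hidden layer, no hidden layer is empty, and one nonzero
weight per hidden layer, one per input and one bias are allowed. -/
theorem ridge_mem_criticClass {r : ℕ} (A : Architecture r 1) {s : ℕ} {F : ℝ} (hF : 1 ≤ F)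
    (hL : 1 ≤ A.depth) (hp : ∀ i, 1 ≤ i → i ≤ A.depth → 1 ≤ A.width i)
    (hs : r + A.depth + 1 ≤ s) (θ : Fin r → ℝ) (v : ℝ) (hθ : (∑ i, |θ i|) + |v| ≤ 1)
    {τ : ℝ} (hτ : |τ| = 1) :
    (fun x => τ * ridge θ v x) ∈ criticClass A s F := by
  have hθi : ∀ i, |θ i| ≤ 1 := fun i => by
    have := Finset.single_le_sum (fun j _ => abs_nonneg (θ j)) (Finset.mem_univ i)
    linarith [abs_nonneg v]
  have hsum : ∑ i, |θ i| ≤ 1 := by linarith [abs_nonneg v]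
  have hv : |v| ≤ 1 := by
    linarith [Finset.sum_nonneg fun (j : Fin r) (_ : j ∈ Finset.univ) => abs_nonneg (θ j)]
  set θ' : ℕ → ℝ := fun j => if h : j < r then θ ⟨j, h⟩ else 0 with hθ'
  have hθ'1 : ∀ j, |θ' j| ≤ 1 := fun j => by
    by_cases h : j < r
    · simpa [hθ', h] using hθi _
    · simp [hθ', h]
  refine ⟨⟨⟨ridgeWeight A.width A.depth θ' τ, ridgeBias A.width v, ?_, ?_, ?_, ?_⟩, ?_⟩, ?_⟩
  · intro l _ i j
    simp only [ridgeWeight]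
    split_ifs <;> simp [hθ'1, hτ]
  · intro l _ _ i
    simp only [ridgeBias]
    split_ifs <;> simp [hv]
  · have h1 : ∑ l ∈ Finset.range (A.depth + 1), Set.ncard
        {ij : Fin (A.width (l + 1)) × Fin (A.width l) |
          ridgeWeight A.width A.depth θ' τ l ij.1 ij.2 ≠ 0} ≤ A.depth + r := by
      rw [Finset.sum_range_succ']
      refine add_le_add ?_ ((ncard_ridgeWeight_zero_le _ _ _ _).trans_eq A.width_zero)
      refine (Finset.sum_le_sum fun l _ => ncard_ridgeWeight_succ_le _ _ _ _ l).trans ?_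
      simp
    have h2 : ∑ l ∈ Finset.Icc 1 A.depth,
        Set.ncard {i : Fin (A.width l) | ridgeBias A.width v l i ≠ 0} ≤ 1 := by
      refine (Finset.sum_le_sum fun l _ => ncard_ridgeBias_le A.width v l).trans ?_
      rw [Finset.sum_ite_eq']
      split_ifs <;> simp
    omega
  · intro x k
    obtain ⟨l, hl⟩ : ∃ l, A.depth = l + 1 := ⟨A.depth - 1, by omega⟩
    have key : ∀ (m : ℕ) (hm : m = A.depth) (i : Fin (A.width (m + 1))), i.val = 0 →
        layerOutput (ridgeWeight A.width A.depth θ' τ) (ridgeBias A.width v)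
          (fun i => x (Fin.cast A.width_zero i)) m i = τ * ridge θ v x := by
      intro m hm i hi
      obtain rfl : m = l + 1 := by omega
      rw [layerOutput_ridge_succ _ _ _ _ _ _ _ (by omega) hp _ hi, if_pos hm, ridge]
      congr 3
      refine Fintype.sum_equiv (finCongr A.width_zero) _ _ fun j => ?_
      have hj : j.val < r := j.isLt.trans_eq A.width_zero
      simp only [hθ', hj, dite_true]
      rfl
    refine (key A.depth rfl _ ?_).symm
    simp
  · intro x hx _
    rw [abs_mul, hτ, one_mul, abs_of_nonneg (ridge_nonneg _ _ _)]
    linarith [ridge_le_of_mem_unitCube θ v hx]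
  · refine LipschitzWith.of_dist_le_mul fun x y => ?_
    rw [Real.dist_eq, ← mul_sub, abs_mul, hτ, one_mul, NNReal.coe_one]
    exact (abs_ridge_sub_le θ v x y).trans (mul_le_mul_of_nonneg_right hsum dist_nonneg)

/-! ### Convergence of expectations on the line -/

/-- `φ (T n)` is eventually integrable, `φ T'` is integrable, and `E φ (T n) → E φ T'`. In contrast
to the bare convergence of Bochner integrals this is closed under linear combinations. -/
def TendstoExpectation {Ω : Type*} [MeasurableSpace Ω] (P : Measure Ω) (T : ℕ → Ω → ℝ)
    (T' : Ω → ℝ) (φ : ℝ → ℝ) : Prop :=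
  (∀ᶠ n in atTop, Integrable (fun ω => φ (T n ω)) P) ∧ Integrable (fun ω => φ (T' ω)) P ∧
    Tendsto (fun n => ∫ ω, φ (T n ω) ∂P) atTop (𝓝 (∫ ω, φ (T' ω) ∂P))

namespace TendstoExpectation

variable {Ω : Type*} [MeasurableSpace Ω] {P : Measure Ω} {T : ℕ → Ω → ℝ} {T' : Ω → ℝ}
  {φ ψ : ℝ → ℝ}

lemma const [IsFiniteMeasure P] (c : ℝ) : TendstoExpectation P T T' (fun _ => c) :=
  ⟨.of_forall fun _ => integrable_const c, integrable_const c, tendsto_const_nhds⟩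

lemma add (h : TendstoExpectation P T T' φ) (h' : TendstoExpectation P T T' ψ) :
    TendstoExpectation P T T' (fun t => φ t + ψ t) := by
  refine ⟨?_, h.2.1.add h'.2.1, ?_⟩
  · filter_upwards [h.1, h'.1] with n hn hn' using hn.add hn'
  · rw [integral_add h.2.1 h'.2.1]
    refine (h.2.2.add h'.2.2).congr' ?_
    filter_upwards [h.1, h'.1] with n hn hn' using (integral_add hn hn').symm

lemma const_mul (c : ℝ) (h : TendstoExpectation P T T' φ) :
    TendstoExpectation P T T' (fun t => c * φ t) := by
  refine ⟨?_, h.2.1.const_mul c, ?_⟩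
  · filter_upwards [h.1] with n hn using hn.const_mul c
  · simp_rw [integral_const_mul]
    exact h.2.2.const_mul c

lemma sub (h : TendstoExpectation P T T' φ) (h' : TendstoExpectation P T T' ψ) :
    TendstoExpectation P T T' (fun t => φ t - ψ t) := by
  simpa [sub_eq_add_neg] using h.add (h'.const_mul (-1))

/-- A function belongs to the class if it can be approximated by members `p` of the class with an
error bound `q` that is also a member and has small expectation in the limit. -/
lemma of_approx (hT : ∀ n, AEMeasurable (T n) P) (hT' : AEMeasurable T' P)
    (hφ : Measurable φ)
    (h : ∀ ε > 0, ∃ p q : ℝ → ℝ, TendstoExpectation P T T' p ∧ TendstoExpectation P T T' q ∧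
      (∀ t, |φ t - p t| ≤ q t) ∧ ∫ ω, q (T' ω) ∂P < ε) :
    TendstoExpectation P T T' φ := by
  have hint : ∀ (U : Ω → ℝ) (p q : ℝ → ℝ), AEMeasurable U P → (∀ t, |φ t - p t| ≤ q t) →
      Integrable (fun ω => p (U ω)) P → Integrable (fun ω => q (U ω)) P →
      Integrable (fun ω => φ (U ω)) P ∧
        |∫ ω, φ (U ω) ∂P - ∫ ω, p (U ω) ∂P| ≤ ∫ ω, q (U ω) ∂P := by
    intro U p q hU hpq hp hq
    have hφU := (hφ.comp_aemeasurable hU).aestronglyMeasurable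
    have h1 : Integrable (fun ω => φ (U ω) - p (U ω)) P :=
      hq.mono' (hφU.sub hp.aestronglyMeasurable) (.of_forall fun ω => hpq _)
    have h2 : Integrable (fun ω => φ (U ω)) P :=
      (h1.add hp).congr (.of_forall fun ω => sub_add_cancel _ _)
    refine ⟨h2, ?_⟩
    rw [← integral_sub h2 hp]
    exact norm_integral_le_of_norm_le (f := fun ω => φ (U ω) - p (U ω)) hq
      (.of_forall fun ω => hpq (U ω))
  obtain ⟨p, q, hp, hq, hpq, -⟩ := h 1 one_pos
  refine ⟨?_, (hint T' p q hT' hpq hp.2.1 hq.2.1).1, ?_⟩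
  · filter_upwards [hp.1, hq.1] with n hn hn' using (hint _ p q (hT n) hpq hn hn').1
  · rw [Metric.tendsto_atTop']
    intro ε hε
    obtain ⟨p, q, hp, hq, hpq, hqε⟩ := h (ε / 3) (by positivity)
    have h1 := (hint T' p q hT' hpq hp.2.1 hq.2.1).2
    have h2 := hq.2.2.eventually_lt_const hqε
    have h3 := (Metric.tendsto_nhds.1 hp.2.2) (ε / 3) (by positivity)
    have h4 : ∀ᶠ n in atTop, dist (∫ ω, φ (T n ω) ∂P) (∫ ω, φ (T' ω) ∂P) < ε := by
      filter_upwards [hp.1, hq.1, h2, h3] with n hpn hqn h2n h3n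
      have h4 := (hint _ p q (hT n) hpq hpn hqn).2
      rw [Real.dist_eq, abs_lt] at *
      rw [abs_le] at h1 h4
      constructor <;> linarith
    obtain ⟨N, hN⟩ := eventually_atTop.1 h4
    exact ⟨N, fun n hn => hN n hn.le⟩

end TendstoExpectation

/-- The continuous function that interpolates `g` linearly between the nodes `a + j h`, `j ≤ k`,
and is constant to the left and to the right of them. -/
noncomputable def linearInterpolant (g : ℝ → ℝ) (a h : ℝ) : ℕ → ℝ → ℝ
  | 0, _ => g a
  | k + 1, t => linearInterpolant g a h k t + (g (a + (k + 1) * h) - g (a + k * h)) / h *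
      (max (t - (a + k * h)) 0 - max (t - (a + (k + 1) * h)) 0)

lemma linearInterpolant_of_ge (g : ℝ → ℝ) (a : ℝ) {h : ℝ} (hh : 0 < h) (k : ℕ) {t : ℝ}
    (ht : a + k * h ≤ t) : linearInterpolant g a h k t = g (a + k * h) := by
  induction k with
  | zero => simp [linearInterpolant]
  | succ k ih =>
    push_cast at ht ⊢
    rw [linearInterpolant, ih (by linarith), max_eq_left (by linarith), max_eq_left (by linarith)]
    field_simp
    ring

lemma linearInterpolant_of_le (g : ℝ → ℝ) (a : ℝ) {h : ℝ} (hh : 0 < h) (k : ℕ) {t : ℝ}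
    (ht : t ≤ a) : linearInterpolant g a h k t = g a := by
  induction k with
  | zero => simp [linearInterpolant]
  | succ k ih =>
    have : 0 ≤ k * h := by positivity
    rw [linearInterpolant, ih, max_eq_right (by linarith), max_eq_right (by linarith)]
    simp

/-- To the right of the last node but one, the interpolant is that node's value plus a linear term
of slope at most `C`, so both it and `g` differ from this value by at most `C h`. -/
lemma abs_sub_linearInterpolant_le {g : ℝ → ℝ} {C : ℝ} (hC : 0 ≤ C)
    (hg : ∀ s t, |g s - g t| ≤ C * |s - t|)
    (a : ℝ) {h : ℝ} (hh : 0 < h) (k : ℕ) {t : ℝ} (hat : a ≤ t) (ht : t ≤ a + k * h) :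
    |g t - linearInterpolant g a h k t| ≤ 2 * C * h := by
  induction k with
  | zero =>
    obtain rfl : t = a := le_antisymm (by simpa using ht) hat
    simp only [linearInterpolant, sub_self, abs_zero]
    positivity
  | succ k ih =>
    push_cast at ht
    rw [linearInterpolant, max_eq_right (by linarith : t - (a + (k + 1) * h) ≤ 0)]
    rcases le_total t (a + k * h) with hk | hk
    · rw [max_eq_right (by linarith)]
      simpa using ih hk
    · rw [max_eq_left (by linarith), linearInterpolant_of_ge g a hh k hk]
      have h1 := hg t (a + k * h)
      rw [abs_of_nonneg (by linarith : 0 ≤ t - (a + k * h))] at h1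
      have h2 : |(g (a + (k + 1) * h) - g (a + k * h)) / h * (t - (a + k * h) - 0)| ≤ C * h := by
        have h3 := hg (a + (k + 1) * h) (a + k * h)
        have h4 : a + (k + 1) * h - (a + k * h) = h := by ring
        rw [h4, abs_of_pos hh] at h3
        rw [sub_zero, abs_mul, abs_div, abs_of_pos hh,
          abs_of_nonneg (by linarith : 0 ≤ t - (a + k * h))]
        refine (mul_le_mul ((div_le_iff₀ hh).2 h3) (by linarith : t - (a + k * h) ≤ h)
          (by linarith) hC)
      have h5 : C * (t - (a + k * h)) ≤ C * h := mul_le_mul_of_nonneg_left (by linarith) hC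
      rw [← sub_sub]
      refine (abs_sub _ _).trans ?_
      linarith

lemma TendstoExpectation.linearInterpolant {Ω : Type*} [MeasurableSpace Ω] {P : Measure Ω}
    [IsFiniteMeasure P] {T : ℕ → Ω → ℝ} {T' : Ω → ℝ}
    (h : ∀ v, TendstoExpectation P T T' fun t => max (t - v) 0) (g : ℝ → ℝ) (a δ : ℝ) (k : ℕ) :
    TendstoExpectation P T T' (WGAN.linearInterpolant g a δ k) := by
  induction k with
  | zero => exact .const _
  | succ k ih => exact ih.add (((h _).sub (h _)).const_mul _)

/-- Convergence of the expectations of all one-dimensional ReLU functions implies convergence of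
the expectations of Lipschitz functions when the limit is bounded by `M`: between `-M` and `M`
a Lipschitz function is close to a linear interpolant, and outside the error is controlled by
`max (t - M) 0` and `max (-t - M) 0`, whose expectations vanish in the limit. -/
theorem TendstoExpectation.of_lipschitz {Ω : Type*} [MeasurableSpace Ω] {P : Measure Ω}
    [IsProbabilityMeasure P] {T : ℕ → Ω → ℝ} {T' : Ω → ℝ}
    (hT : ∀ n, AEMeasurable (T n) P) (hT' : AEMeasurable T' P) {M : ℝ} (hM : 0 < M)
    (hbound : ∀ᵐ ω ∂P, |T' ω| ≤ M)
    (h : ∀ v, TendstoExpectation P T T' fun t => max (t - v) 0)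
    (h' : ∀ v, TendstoExpectation P T T' fun t => max (-t - v) 0)
    {g : ℝ → ℝ} {C : ℝ} (hC : 0 ≤ C) (hg : ∀ s t, |g s - g t| ≤ C * |s - t|)
    (hgm : Measurable g) : TendstoExpectation P T T' g := by
  refine .of_approx hT hT' hgm fun ε hε => ?_
  -- with `N` intervals of length `δ = 2 M / N` the interpolation error `2 C δ` is less than `ε`
  obtain ⟨N, hN⟩ := exists_nat_gt (4 * C * M / ε)
  have hN0 : (0 : ℝ) < N := lt_of_le_of_lt (by positivity) hN
  set δ : ℝ := 2 * M / N with hδ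
  have hδ0 : 0 < δ := by positivity
  have hend : -M + N * δ = M := by rw [hδ]; field_simp; ring
  refine ⟨WGAN.linearInterpolant g (-M) δ N,
    fun t => 2 * C * δ + C * (max (t - M) 0 + max (-t - M) 0),
    .linearInterpolant h g _ _ _, .add (.const _) (((h M).add (h' M)).const_mul C), fun t => ?_, ?_⟩
  · have hδC : 0 ≤ 2 * C * δ := by positivity
    have hr := le_max_left (t - M) 0
    have hr' := le_max_right (t - M) 0
    have hl := le_max_left (-t - M) 0
    have hl' := le_max_right (-t - M) 0
    rcases le_total t (-M) with h1 | h1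
    · rw [linearInterpolant_of_le g _ hδ0 _ h1]
      refine (hg _ _).trans ?_
      rw [abs_of_nonpos (by linarith)]
      have := mul_le_mul_of_nonneg_left
        (by linarith : -(t - -M) ≤ max (t - M) 0 + max (-t - M) 0) hC
      linarith
    rcases le_total t M with h2 | h2
    · refine (abs_sub_linearInterpolant_le hC hg _ hδ0 N h1 (by rw [hend]; exact h2)).trans ?_
      have : 0 ≤ C * (max (t - M) 0 + max (-t - M) 0) := mul_nonneg hC (by linarith)
      linarith
    · rw [linearInterpolant_of_ge g _ hδ0 _ (by rw [hend]; exact h2), hend]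
      refine (hg _ _).trans ?_
      rw [abs_of_nonneg (by linarith)]
      have := mul_le_mul_of_nonneg_left
        (by linarith : t - M ≤ max (t - M) 0 + max (-t - M) 0) hC
      linarith
  · have : (fun ω => 2 * C * δ + C * (max (T' ω - M) 0 + max (-T' ω - M) 0)) =ᵐ[P]
        fun _ => 2 * C * δ := by
      filter_upwards [hbound] with ω hω
      rw [abs_le] at hω
      rw [max_eq_right (by linarith), max_eq_right (by linarith)]
      ring
    rw [integral_congr_ae this, integral_const, probReal_univ, one_smul, hδ]
    rw [div_lt_iff₀ hε] at hN
    rw [← mul_div_assoc, div_lt_iff₀ hN0]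
    linarith

/-! ### Ridge functions determine convergence in distribution -/

/-- If `E (max (θ ⬝ V n - v) 0) → E (max (θ ⬝ V' - v) 0)` for all `θ` and `v` and `V'` takes values
in the cube, then `V n → V'` in distribution: every projection `θ ⬝ V n` has converging expectations
of `cos` and `sin`, so the characteristic functions converge. -/
theorem tendstoInDistribution_of_ridge {Ω : Type*} [MeasurableSpace Ω] {P : Measure Ω}
    [IsProbabilityMeasure P] {r : ℕ} {V : ℕ → Ω → Fin r → ℝ} {V' : Ω → Fin r → ℝ}
    (hV : ∀ n, Measurable (V n)) (hV' : Measurable V') (hcube : ∀ᵐ ω ∂P, V' ω ∈ unitCube r)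
    (h : ∀ θ v, (∀ᶠ n in atTop, Integrable (fun ω => ridge θ v (V n ω)) P) ∧
      Tendsto (fun n => ∫ ω, ridge θ v (V n ω) ∂P) atTop (𝓝 (∫ ω, ridge θ v (V' ω) ∂P))) :
    TendstoInDistribution V atTop V' (fun _ => P) P := by
  have hint : ∀ θ v, Integrable (fun ω => ridge θ v (V' ω)) P := fun θ v => by
    refine Integrable.of_bound ((continuous_ridge θ v).measurable.comp hV').aestronglyMeasurable
      ((∑ i, |θ i|) + |v|) ?_
    filter_upwards [hcube] with ω hω
    rw [Real.norm_eq_abs, abs_of_nonneg (ridge_nonneg _ _ _)]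
    exact ridge_le_of_mem_unitCube θ v hω
  have key : ∀ (θ : Fin r → ℝ) (g : ℝ → ℝ), Measurable g → (∀ s t, |g s - g t| ≤ 1 * |s - t|) →
      Tendsto (fun n => ∫ ω, g (∑ i, θ i * V n ω i) ∂P) atTop
        (𝓝 (∫ ω, g (∑ i, θ i * V' ω i) ∂P)) := by
    intro θ g hgm hg
    refine (TendstoExpectation.of_lipschitz (P := P) (T := fun n ω => ∑ i, θ i * V n ω i)
      (T' := fun ω => ∑ i, θ i * V' ω i) (M := (∑ i, |θ i|) + 1) (C := 1)
      (fun n => ?_) ?_ (by positivity) ?_ (fun v => ?_) (fun v => ?_) zero_le_one hg hgm).2.2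
    · have := hV n; fun_prop
    · fun_prop
    · filter_upwards [hcube] with ω hω
      linarith [abs_sum_mul_le_of_mem_unitCube θ hω]
    · exact ⟨(h θ v).1, hint θ v, (h θ v).2⟩
    · have hneg : ∀ x : Fin r → ℝ, max (-(∑ i, θ i * x i) - v) 0 = ridge (fun i => -θ i) v x := by
        intro x
        simp [ridge]
      simp only [TendstoExpectation, hneg]
      exact ⟨(h _ v).1, hint _ v, (h _ v).2⟩
  have hexp : ∀ (t : EuclideanSpace ℝ (Fin r)) (U : Ω → Fin r → ℝ), Measurable U →
      charFun (P.map fun ω => WithLp.toLp 2 (U ω)) t =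
        ((∫ ω, Real.cos (∑ i, t i * U ω i) ∂P : ℝ) : ℂ) +
          ((∫ ω, Real.sin (∑ i, t i * U ω i) ∂P : ℝ) : ℂ) * Complex.I := by
    intro t U hU
    have hU' : Measurable fun ω => (WithLp.toLp 2 (U ω) : EuclideanSpace ℝ (Fin r)) := by fun_prop
    rw [charFun_apply, integral_map hU'.aemeasurable (by fun_prop), ← integral_complex_ofReal,
      ← integral_complex_ofReal, ← integral_mul_const, ← integral_add]
    · refine integral_congr_ae (.of_forall fun ω => ?_)
      simp only [Complex.exp_mul_I, PiLp.inner_apply, Complex.ofReal_cos, Complex.ofReal_sin]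
      rfl
    · refine Integrable.of_bound (by fun_prop) 1 (.of_forall fun ω => ?_)
      rw [Complex.norm_real]
      exact Real.abs_cos_le_one _
    · refine Integrable.of_bound (by fun_prop) 1 (.of_forall fun ω => ?_)
      rw [norm_mul, Complex.norm_real, Complex.norm_I, mul_one]
      exact Real.abs_sin_le_one _
  have hE : TendstoInDistribution (fun n ω => (WithLp.toLp 2 (V n ω) : EuclideanSpace ℝ (Fin r)))
      atTop (fun ω => WithLp.toLp 2 (V' ω)) (fun _ => P) P := by
    refine ⟨fun n => ?_, by fun_prop, ?_⟩
    · have := hV n; fun_prop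
    · refine ProbabilityMeasure.tendsto_iff_tendsto_charFun.2 fun t => ?_
      simp only [ProbabilityMeasure.coe_mk]
      rw [hexp t V' hV']
      simp_rw [fun n => hexp t (V n) (hV n)]
      refine Tendsto.add ?_ (Tendsto.mul_const _ ?_)
      · refine (Complex.continuous_ofReal.tendsto _).comp (key t.ofLp _ (by fun_prop) fun x y => ?_)
        rw [one_mul]
        exact Real.abs_cos_sub_cos_le _ _
      · refine (Complex.continuous_ofReal.tendsto _).comp (key t.ofLp _ (by fun_prop) fun x y => ?_)
        rw [one_mul]
        exact Real.abs_sin_sub_sin_le _ _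
  exact hE.continuous_comp (g := fun x : EuclideanSpace ℝ (Fin r) => x.ofLp) (by fun_prop)

/-! ### Independence and conditional laws -/

lemma lintegral_comp_of_indepFun {Ω α β : Type*} {mΩ : MeasurableSpace Ω} {mα : MeasurableSpace α}
    {mβ : MeasurableSpace β} {P : Measure Ω} [IsProbabilityMeasure P] {U : Ω → α} {W : Ω → β}
    (hU : Measurable U) (hW : Measurable W) (hUW : IndepFun U W P) {f : α × β → ℝ≥0∞}
    (hf : Measurable f) :
    ∫⁻ ω, f (U ω, W ω) ∂P = ∫⁻ ω, ∫⁻ ω', f (U ω, W ω') ∂P ∂P := by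
  have h := (indepFun_iff_map_prod_eq_prod_map_map hU.aemeasurable hW.aemeasurable).1 hUW
  have := Measure.isProbabilityMeasure_map (μ := P) hW.aemeasurable
  rw [← lintegral_map hf (hU.prodMk hW), h, lintegral_prod _ hf.aemeasurable,
    lintegral_map hf.lintegral_prod_right' hU]
  refine lintegral_congr fun ω => ?_
  exact lintegral_map (hf.comp measurable_prodMk_left) hW

lemma integral_comp_of_indepFun {Ω α β : Type*} {mΩ : MeasurableSpace Ω} {mα : MeasurableSpace α}
    {mβ : MeasurableSpace β} {P : Measure Ω} [IsProbabilityMeasure P] {U : Ω → α} {W : Ω → β}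
    (hU : Measurable U) (hW : Measurable W) (hUW : IndepFun U W P) {k : α × β → ℝ} {φ : β → ℝ}
    (hk : Measurable k) {C : ℝ} (hkC : ∀ x, ‖k x‖ ≤ C) (hφ : Integrable φ (P.map W)) :
    ∫ y, φ y * ∫ ω, k (U ω, y) ∂P ∂(P.map W) = ∫ ω, φ (W ω) * k (U ω, W ω) ∂P := by
  have h := (indepFun_iff_map_prod_eq_prod_map_map hU.aemeasurable hW.aemeasurable).1 hUW
  have := Measure.isProbabilityMeasure_map (μ := P) hU.aemeasurable
  have := Measure.isProbabilityMeasure_map (μ := P) hW.aemeasurable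
  have hint : Integrable (fun x : α × β => φ x.2 * k x) ((P.map U).prod (P.map W)) :=
    (hφ.comp_snd (P.map U)).mul_bdd hk.aestronglyMeasurable (.of_forall hkC)
  rw [← integral_map (f := fun x : α × β => φ x.2 * k x) (hU.prodMk hW).aemeasurable
    (by rw [h]; exact hint.aestronglyMeasurable), h, integral_prod_symm _ hint]
  refine integral_congr_ae (.of_forall fun y => ?_)
  simp only
  rw [integral_const_mul, integral_map hU.aemeasurable]
  exact (hk.comp measurable_prodMk_right).aestronglyMeasurable

lemma indepFun_id_of_indep {Ω β : Type*} {m mΩ : MeasurableSpace Ω} {mβ : MeasurableSpace β}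
    {P : Measure[mΩ] Ω} {W : Ω → β} (h : Indep m (mβ.comap W) P) :
    @IndepFun Ω Ω β mΩ m mβ id W P :=
  (@IndepFun_iff_Indep Ω Ω β mΩ m mβ id W P).2 (by rwa [MeasurableSpace.comap_id])

lemma indepFun_prodMk_of_indepFun {Ω α β γ : Type*} {mΩ : MeasurableSpace Ω}
    {mα : MeasurableSpace α} {mβ : MeasurableSpace β} {mγ : MeasurableSpace γ} {P : Measure Ω}
    [IsProbabilityMeasure P] {U : Ω → α} {Z : Ω → β} {Y : Ω → γ}
    (hU : Measurable U) (hZ : Measurable Z) (hY : Measurable Y)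
    (h : IndepFun U (fun ω => (Z ω, Y ω)) P) (hZY : IndepFun Z Y P) :
    IndepFun (fun ω => (U ω, Z ω)) Y P := by
  have h1 := (indepFun_iff_map_prod_eq_prod_map_map hU.aemeasurable
    (hZ.prodMk hY).aemeasurable).1 h
  have h2 := (indepFun_iff_map_prod_eq_prod_map_map hZ.aemeasurable hY.aemeasurable).1 hZY
  have h3 := (indepFun_iff_map_prod_eq_prod_map_map hU.aemeasurable hZ.aemeasurable).1
    (h.comp measurable_id measurable_fst)
  have := Measure.isProbabilityMeasure_map (μ := P) hU.aemeasurable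
  have := Measure.isProbabilityMeasure_map (μ := P) hZ.aemeasurable
  have := Measure.isProbabilityMeasure_map (μ := P) hY.aemeasurable
  rw [indepFun_iff_map_prod_eq_prod_map_map (hU.prodMk hZ).aemeasurable hY.aemeasurable, h3]
  apply (MeasurableEquiv.prodAssoc (α := α) (β := β) (γ := γ)).map_measurableEquiv_injective
  rw [Measure.prodAssoc_prod, ← h2, ← h1, Measure.map_map (by fun_prop) (by fun_prop)]
  rfl

/-- Joint convergence in distribution of `(X n, Y)` allows test functions `φ(y) h(x)` with `h`
bounded continuous and `φ` merely integrable: the law of the second component is fixed, so `φ` can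
be replaced by a bounded continuous function up to a small error in `L¹`. -/
lemma tendsto_integral_mul_of_tendstoInDistribution {Ω E F : Type*} [MeasurableSpace Ω]
    [TopologicalSpace E] [MeasurableSpace E] [BorelSpace E]
    [MetricSpace F] [MeasurableSpace F] [BorelSpace F] [SecondCountableTopologyEither E F]
    [OpensMeasurableSpace (E × F)]
    {P : Measure Ω} [IsProbabilityMeasure P] {X : ℕ → Ω → E} {X' : Ω → E} {Y : Ω → F}
    (hY : Measurable Y) (hX : ∀ n, Measurable (X n)) (hX' : Measurable X')
    (h : TendstoInDistribution (fun n ω => (X n ω, Y ω)) atTop (fun ω => (X' ω, Y ω))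
      (fun _ => P) P)
    (k : E →ᵇ ℝ) (φ : F → ℝ) (hφ : Integrable φ (P.map Y)) :
    Tendsto (fun n => ∫ ω, φ (Y ω) * k (X n ω) ∂P) atTop
      (𝓝 (∫ ω, φ (Y ω) * k (X' ω) ∂P)) := by
  have := Measure.isProbabilityMeasure_map (μ := P) hY.aemeasurable
  rw [Metric.tendsto_nhds]
  intro ε hε
  obtain ⟨ψ, hψ, hψi⟩ := hφ.exists_boundedContinuous_integral_sub_le
    (ε := ε / (4 * (‖k‖ + 1))) (by positivity)
  set kψ : E × F →ᵇ ℝ := (ψ.compContinuous ⟨Prod.snd, continuous_snd⟩) *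
    (k.compContinuous ⟨Prod.fst, continuous_fst⟩) with hkψ
  have hlim := (ProbabilityMeasure.tendsto_iff_forall_integral_tendsto.1 h.tendsto) kψ
  have hm : ∀ U : Ω → E, Measurable U → AEMeasurable (fun ω => (U ω, Y ω)) P →
      ∫ x, kψ x ∂(P.map fun ω => (U ω, Y ω)) = ∫ ω, ψ (Y ω) * k (U ω) ∂P := by
    intro U hU hUY
    rw [integral_map hUY kψ.continuous.aestronglyMeasurable]
    rfl
  simp only [ProbabilityMeasure.coe_mk] at hlim
  rw [hm X' hX' h.aemeasurable_limit] at hlim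
  simp_rw [fun n => hm (X n) (hX n) (h.forall_aemeasurable n)] at hlim
  have hφY : Integrable (fun ω => φ (Y ω)) P := hφ.comp_measurable hY
  have hψY : Integrable (fun ω => ψ (Y ω)) P := hψi.comp_measurable hY
  have hclose : ∀ U : Ω → E, Measurable U →
      |∫ ω, φ (Y ω) * k (U ω) ∂P - ∫ ω, ψ (Y ω) * k (U ω) ∂P| ≤ ε / 4 := by
    intro U hU
    have hkU : AEStronglyMeasurable (fun ω => k (U ω)) P :=
      (k.continuous.measurable.comp hU).aestronglyMeasurable
    have hb : ∀ᵐ ω ∂P, ‖k (U ω)‖ ≤ ‖k‖ := .of_forall fun ω => k.norm_coe_le_norm _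
    rw [← integral_sub (hφY.mul_bdd hkU hb) (hψY.mul_bdd hkU hb)]
    have h1 : |∫ ω, (φ (Y ω) * k (U ω) - ψ (Y ω) * k (U ω)) ∂P| ≤
        ∫ ω, ‖φ (Y ω) - ψ (Y ω)‖ * ‖k‖ ∂P := by
      refine norm_integral_le_of_norm_le
        (f := fun ω => φ (Y ω) * k (U ω) - ψ (Y ω) * k (U ω)) ((hφY.sub hψY).norm.mul_const _)
        (.of_forall fun ω => ?_)
      rw [← sub_mul, norm_mul]
      exact mul_le_mul_of_nonneg_left (k.norm_coe_le_norm _) (norm_nonneg _)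
    rw [integral_mul_const, ← integral_map (f := fun y => ‖φ y - ψ y‖) hY.aemeasurable
      (hφ.sub hψi).norm.aestronglyMeasurable] at h1
    refine h1.trans ((mul_le_mul_of_nonneg_right hψ (norm_nonneg _)).trans ?_)
    rw [div_mul_eq_mul_div, div_le_div_iff₀ (by positivity) (by positivity)]
    nlinarith [norm_nonneg k]
  filter_upwards [Metric.tendsto_nhds.1 hlim (ε / 4) (by positivity)] with n hn
  have h1 := abs_le.1 (hclose _ (hX n))
  have h2 := abs_le.1 (hclose _ hX')
  rw [Real.dist_eq, abs_lt] at *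
  constructor <;> linarith [h1.1, h1.2, h2.1, h2.2]

lemma integral_mul_condDistrib {Ω E F : Type*} [MeasurableSpace Ω] [MeasurableSpace E]
    [StandardBorelSpace E] [Nonempty E] [MeasurableSpace F] {P : Measure Ω} [IsProbabilityMeasure P]
    {X : Ω → E} {Y : Ω → F} (hX : Measurable X) (hY : Measurable Y) {k : E → ℝ} (hk : Measurable k)
    {C : ℝ} (hkC : ∀ x, ‖k x‖ ≤ C) {φ : F → ℝ} (hφ : Integrable φ (P.map Y)) :
    ∫ y, φ y * ∫ x, k x ∂(condDistrib X Y P y) ∂(P.map Y) = ∫ ω, φ (Y ω) * k (X ω) ∂P := by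
  have := Measure.isProbabilityMeasure_map (μ := P) hY.aemeasurable
  have hφm : AEStronglyMeasurable (fun z : F × E => φ z.1) (P.map fun ω => (Y ω, X ω)) := by
    refine AEStronglyMeasurable.comp_measurable (g := φ) (f := Prod.fst) ?_ measurable_fst
    rw [Measure.map_map measurable_fst (hY.prodMk hX)]
    exact hφ.aestronglyMeasurable
  have hfm : AEStronglyMeasurable (fun z : F × E => φ z.1 * k z.2) (P.map fun ω => (Y ω, X ω)) :=
    hφm.mul (hk.comp measurable_snd).aestronglyMeasurable
  have hint : Integrable (fun z : F × E => φ z.1 * k z.2) (P.map fun ω => (Y ω, X ω)) := by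
    rw [integrable_map_measure hfm (hY.prodMk hX).aemeasurable]
    exact (hφ.comp_measurable hY).mul_bdd (hk.comp hX).aestronglyMeasurable
      (.of_forall fun _ => hkC _)
  rw [← integral_map (f := fun z : F × E => φ z.1 * k z.2) (hY.prodMk hX).aemeasurable hfm,
    ← compProd_map_condDistrib hX.aemeasurable, Measure.integral_compProd]
  · simp_rw [integral_const_mul]
  · rwa [compProd_map_condDistrib hX.aemeasurable]

/-! ### Convergence of the critics -/

lemma measurable_append {m n : ℕ} :
    Measurable fun p : (Fin m → ℝ) × (Fin n → ℝ) => Fin.append p.1 p.2 :=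
  (Fin.appendHomeomorph m n).continuous.measurable

lemma append_mem_unitCube {m n : ℕ} {x : Fin m → ℝ} {y : Fin n → ℝ} (hx : x ∈ unitCube m)
    (hy : y ∈ unitCube n) : Fin.append x y ∈ unitCube (m + n) :=
  ⟨fun i => by
    cases i using Fin.addCases 
    · simpa using hx.1 _
    · simpa using hy.1 _,
    fun i => by
    cases i using Fin.addCases
    · simpa using hx.2 _
    · simpa using hy.2 _⟩

/-- If both `f` and `-f` are critics, then `W^c` bounds the distance of the two expectations. -/
lemma abs_integral_sub_integral_le_conditionalW {Ω : Type*} [MeasurableSpace Ω] (P : Measure Ω)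
    {d dY dZ : ℕ} (X : Ω → Fin d → ℝ) (Y : Ω → Fin dY → ℝ) (Z : Ω → Fin dZ → ℝ)
    (A : Architecture (d + dY) 1) (s : ℕ) (F : ℝ) (g : (Fin (dZ + dY) → ℝ) → (Fin d → ℝ))
    {f : (Fin (d + dY) → ℝ) → ℝ} (hf : f ∈ criticClass A s F)
    (hf' : (fun x => -f x) ∈ criticClass A s F) :
    ENNReal.ofReal |(∫ ω, f (Fin.append (X ω) (Y ω)) ∂P) -
      ∫ ω, f (Fin.append (g (Fin.append (Z ω) (Y ω))) (Y ω)) ∂P| ≤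
        (conditionalW P X Y Z A s F g).toENNReal := by
  suffices h : ((|(∫ ω, f (Fin.append (X ω) (Y ω)) ∂P) -
      ∫ ω, f (Fin.append (g (Fin.append (Z ω) (Y ω))) (Y ω)) ∂P| : ℝ) : EReal) ≤
        conditionalW P X Y Z A s F g by
    have h' := EReal.toENNReal_le_toENNReal h
    rwa [EReal.toENNReal_of_ne_top (EReal.coe_ne_top _), EReal.toReal_coe] at h'
  set a := ∫ ω, f (Fin.append (X ω) (Y ω)) ∂P with ha
  set b := ∫ ω, f (Fin.append (g (Fin.append (Z ω) (Y ω))) (Y ω)) ∂P with hb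
  rcases abs_choice (a - b) with h | h <;> rw [h]
  · exact le_iSup₂_of_le f hf le_rfl
  · refine le_iSup₂_of_le _ hf' ?_
    rw [integral_neg, integral_neg, neg_sub, sub_neg_eq_add, neg_add_eq_sub]

lemma integrable_ridge_comp {Ω : Type*} [MeasurableSpace Ω] {P : Measure Ω} [IsFiniteMeasure P]
    {r : ℕ} (θ : Fin r → ℝ) (v : ℝ) {V : Ω → Fin r → ℝ} (hV : ∀ i, Integrable (fun ω => V ω i) P) :
    Integrable (fun ω => ridge θ v (V ω)) P :=
  ((integrable_finsetSum _ fun i _ => (hV i).const_mul (θ i)).sub (integrable_const v)).sup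
    (integrable_const 0)

lemma tendsto_natCast_mul_rpow_atTop {γ d : ℝ} (hγ : 1 ≤ γ) (hd : 0 < d) :
    Tendsto (fun n : ℕ => (n : ℝ) * (n : ℝ) ^ (-(2 * γ / (2 * γ + d)))) atTop atTop := by
  have h : Tendsto (fun n : ℕ => (n : ℝ) ^ (1 + -(2 * γ / (2 * γ + d)))) atTop atTop := by
    refine (tendsto_rpow_atTop ?_).comp tendsto_natCast_atTop_atTop
    rw [← sub_eq_add_neg, sub_pos, div_lt_one (by linarith)]
    linarith
  refine h.congr' ?_
  filter_upwards [eventually_gt_atTop 0] with n hn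
  rw [Real.rpow_add (by exact_mod_cast hn), Real.rpow_one]

/-- Under the growth conditions all architectures are eventually large enough to contain the
small ridge functions. -/
lemma eventually_ridge_mem_criticClass {r : ℕ} {d : ℕ} (hd : 0 < d) {γ F c : ℝ}
    (hγ : 1 ≤ γ) (hF : 1 ≤ F) (hc : 0 < c) (A : ℕ → Architecture r 1) (s : ℕ → ℕ)
    (hdepth : ∀ᶠ n : ℕ in atTop,
      Real.logb 2 n * Real.logb 2 (max (4 * (d : ℝ)) (4 * γ)) ≤ (A n).depth)
    (hwidth : ∀ᶠ n : ℕ in atTop, ∀ i, 1 ≤ i → i ≤ (A n).depth →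
      c * (n * (n : ℝ) ^ (-(2 * γ / (2 * γ + d)))) ≤ (A n).width i)
    (hsparse : ∀ᶠ n : ℕ in atTop,
      c * (Real.log n * (n * (n : ℝ) ^ (-(2 * γ / (2 * γ + d))))) ≤ s n)
    (hdepth_sparse : (fun n => ((A n).depth : ℝ)) =o[atTop] (fun n => (s n : ℝ))) :
    ∀ᶠ n in atTop, ∀ (θ : Fin r → ℝ) (v : ℝ), (∑ i, |θ i|) + |v| ≤ 1 → ∀ τ : ℝ, |τ| = 1 →
      (fun x => τ * ridge θ v x) ∈ criticClass (A n) (s n) F := by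
  have hna := tendsto_natCast_mul_rpow_atTop hγ (Nat.cast_pos.2 hd : (0 : ℝ) < d)
  have hs : Tendsto (fun n => (s n : ℝ)) atTop atTop := by
    refine tendsto_atTop_mono' _ hsparse (Tendsto.const_mul_atTop hc ?_)
    exact (Real.tendsto_log_atTop.comp tendsto_natCast_atTop_atTop).atTop_mul_atTop₀ hna
  filter_upwards [hdepth, hwidth, (hna.const_mul_atTop hc).eventually_ge_atTop 1,
    hs.eventually_ge_atTop (2 * (r + 1)), hdepth_sparse.bound (by norm_num : (0 : ℝ) < 1 / 2),
    eventually_ge_atTop 2] with n hL hp hp1 hs hLs hn θ v hθ τ hτ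
  refine ridge_mem_criticClass (A n) hF ?_ (fun i h1 h2 => ?_) ?_ θ v hθ hτ
  · -- both factors of the lower bound on the depth are at least `1`
    have h1 : 1 ≤ Real.logb 2 n := by
      rw [Real.le_logb_iff_rpow_le one_lt_two (by positivity), Real.rpow_one]
      exact_mod_cast hn
    have h2 : 1 ≤ Real.logb 2 (max (4 * (d : ℝ)) (4 * γ)) := by
      have : 2 ≤ max (4 * (d : ℝ)) (4 * γ) := le_max_of_le_right (by linarith)
      rw [Real.le_logb_iff_rpow_le one_lt_two (by linarith), Real.rpow_one]
      exact this
    exact_mod_cast (one_le_mul_of_one_le_of_one_le h1 h2).trans hL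
  · exact_mod_cast hp1.trans (hp i h1 h2)
  · simp only [Real.norm_eq_abs, Nat.abs_cast] at hLs
    have : ((r + (A n).depth + 1 : ℕ) : ℝ) ≤ s n := by push_cast; linarith
    exact_mod_cast this

/-- If `E W^c(ĝ_n) → 0` and `f ≥ 0` is eventually a critic together with `-f`, then
`E f(ĝ_n(Z, Y), Y) → E f(X, Y)`. By independence the left-hand side is the mean of
`E f(ĝ_n(ω)(Z, Y), Y)` over `ω`, which differs from `E f(X, Y)` by at most `W^c(ĝ_n(ω))`. The
expectations on the left are lower integrals, so that finiteness is part of the conclusion. -/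
lemma tendsto_lintegral_critic {Ω : Type*} [MeasurableSpace Ω] (P : Measure Ω)
    [IsProbabilityMeasure P] {d dY dZ : ℕ} {F : ℝ}
    (X : Ω → Fin d → ℝ) (Y : Ω → Fin dY → ℝ) (Z : Ω → Fin dZ → ℝ)
    (hY : Measurable Y) (hZ : Measurable Z)
    (A : ℕ → Architecture (d + dY) 1) (s : ℕ → ℕ)
    (𝒯 : ℕ → MeasurableSpace Ω) (h𝒯 : ∀ n, 𝒯 n ≤ ‹MeasurableSpace Ω›)
    (h𝒯indep : ∀ n, Indep (𝒯 n)
      (MeasurableSpace.comap (fun ω => (Z ω, Y ω)) inferInstance) P)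
    (ghat : ℕ → Ω → (Fin (dZ + dY) → ℝ) → (Fin d → ℝ))
    (hghat : ∀ n, Measurable[(𝒯 n).prod inferInstance]
      (fun q : Ω × (Fin (dZ + dY) → ℝ) => ghat n q.1 q.2))
    (hW : Tendsto
      (fun n => ∫⁻ ω, (conditionalW P X Y Z (A n) (s n) F (ghat n ω)).toENNReal ∂P)
      atTop (𝓝 0))
    {f : (Fin (d + dY) → ℝ) → ℝ} (hf0 : ∀ x, 0 ≤ f x) (hfc : Continuous f)
    (hfi : ∀ n, ∀ᵐ ω ∂P,
      Integrable (fun ω' => f (Fin.append (ghat n ω (Fin.append (Z ω') (Y ω'))) (Y ω'))) P)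
    (hf : ∀ᶠ n in atTop, f ∈ criticClass (A n) (s n) F ∧
      (fun x => -f x) ∈ criticClass (A n) (s n) F) :
    Tendsto (fun n => ∫⁻ ω, ENNReal.ofReal
        (f (Fin.append (ghat n ω (Fin.append (Z ω) (Y ω))) (Y ω))) ∂P) atTop
      (𝓝 (ENNReal.ofReal (∫ ω, f (Fin.append (X ω) (Y ω)) ∂P))) := by
  set a := ∫ ω, f (Fin.append (X ω) (Y ω)) ∂P with ha
  set J : ℕ → Ω → ℝ≥0∞ := fun n ω => ∫⁻ ω', ENNReal.ofReal
    (f (Fin.append (ghat n ω (Fin.append (Z ω') (Y ω'))) (Y ω'))) ∂P with hJ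
  set W : ℕ → Ω → ℝ≥0∞ := fun n ω =>
    (conditionalW P X Y Z (A n) (s n) F (ghat n ω)).toENNReal with hWdef
  have hfubini : ∀ n, Measurable (J n) ∧ ∫⁻ ω, ENNReal.ofReal
      (f (Fin.append (ghat n ω (Fin.append (Z ω) (Y ω))) (Y ω))) ∂P = ∫⁻ ω, J n ω ∂P := by
    intro n
    have hG : @Measurable _ _ ((𝒯 n).prod inferInstance) _
        (fun q : Ω × ((Fin dZ → ℝ) × (Fin dY → ℝ)) =>
          ENNReal.ofReal (f (Fin.append (ghat n q.1 (Fin.append q.2.1 q.2.2)) q.2.2))) := by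
      let _ : MeasurableSpace Ω := 𝒯 n
      have h1 : Measurable (fun q : Ω × ((Fin dZ → ℝ) × (Fin dY → ℝ)) =>
          ghat n q.1 (Fin.append q.2.1 q.2.2)) :=
        (hghat n).comp (measurable_fst.prodMk (measurable_append.comp measurable_snd))
      exact ENNReal.measurable_ofReal.comp (hfc.measurable.comp
        (measurable_append.comp (h1.prodMk (measurable_snd.comp measurable_snd))))
    -- `ω ↦ ω`, as a map to `Ω` with the σ-algebra `𝒯 n`, is the input independent of `(Z, Y)`
    have hid : @Measurable Ω Ω _ (𝒯 n) id := measurable_id'' (h𝒯 n)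
    have hind : @IndepFun Ω Ω _ _ (𝒯 n) _ id (fun ω => (Z ω, Y ω)) P :=
      indepFun_id_of_indep (h𝒯indep n)
    have hG' : Measurable (fun q : Ω × ((Fin dZ → ℝ) × (Fin dY → ℝ)) =>
          ENNReal.ofReal (f (Fin.append (ghat n q.1 (Fin.append q.2.1 q.2.2)) q.2.2))) :=
      hG.mono (sup_le_sup (MeasurableSpace.comap_mono (h𝒯 n)) le_rfl) le_rfl
    refine ⟨Measurable.lintegral_prod_right' (f := fun q : Ω × Ω => ENNReal.ofReal
      (f (Fin.append (ghat n q.1 (Fin.append (Z q.2) (Y q.2))) (Y q.2)))) ?_, ?_⟩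
    · exact hG'.comp (measurable_fst.prodMk ((hZ.prodMk hY).comp measurable_snd))
    · exact @lintegral_comp_of_indepFun Ω Ω _ _ (𝒯 n) _ P _ id _ hid (hZ.prodMk hY) hind _ hG
  simp_rw [fun n => (hfubini n).2]
  have hdist : ∀ᶠ n in atTop, ∀ᵐ ω ∂P,
      J n ω ≤ ENNReal.ofReal a + W n ω ∧ ENNReal.ofReal a ≤ J n ω + W n ω := by
    filter_upwards [hf] with n hn
    filter_upwards [hfi n] with ω hω
    have h1 : J n ω = ENNReal.ofReal
        (∫ ω', f (Fin.append (ghat n ω (Fin.append (Z ω') (Y ω'))) (Y ω')) ∂P) :=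
      (ofReal_integral_eq_lintegral_ofReal hω (.of_forall fun _ => hf0 _)).symm
    have h2 := abs_integral_sub_integral_le_conditionalW P X Y Z (A n) (s n) F (ghat n ω) hn.1 hn.2
    rw [h1]
    set b := ∫ ω', f (Fin.append (ghat n ω (Fin.append (Z ω') (Y ω'))) (Y ω')) ∂P
    have hb : 0 ≤ b := integral_nonneg fun _ => hf0 _
    have ha' : 0 ≤ a := integral_nonneg fun _ => hf0 _
    constructor
    · refine le_trans ?_ (add_le_add_right h2 _)
      rw [← ENNReal.ofReal_add ha' (abs_nonneg _)]
      exact ENNReal.ofReal_le_ofReal (by linarith [neg_abs_le (a - b)])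
    · refine le_trans ?_ (add_le_add_right h2 _)
      rw [← ENNReal.ofReal_add hb (abs_nonneg _)]
      exact ENNReal.ofReal_le_ofReal (by linarith [le_abs_self (a - b)])
  refine tendsto_of_tendsto_of_tendsto_of_le_of_le'
    (g := fun n => ENNReal.ofReal a - ∫⁻ ω, W n ω ∂P)
    (h := fun n => ENNReal.ofReal a + ∫⁻ ω, W n ω ∂P) ?_ ?_ ?_ ?_
  · simpa using ENNReal.Tendsto.sub (tendsto_const_nhds (x := ENNReal.ofReal a)) hW
      (Or.inl ENNReal.ofReal_ne_top)
  · simpa using (tendsto_const_nhds (x := ENNReal.ofReal a)).add hW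
  · filter_upwards [hdist] with n hn
    -- `W n` is not known to be measurable, so additivity rests on the measurability of `J n`
    rw [tsub_le_iff_right, ← lintegral_add_left (hfubini n).1]
    calc ENNReal.ofReal a = ∫⁻ _, ENNReal.ofReal a ∂P := by simp
      _ ≤ _ := lintegral_mono_ae (hn.mono fun ω h => h.2)
  · filter_upwards [hdist] with n hn
    calc ∫⁻ ω, J n ω ∂P ≤ ∫⁻ ω, (ENNReal.ofReal a + W n ω) ∂P :=
          lintegral_mono_ae (hn.mono fun ω h => h.1)
      _ = _ := by rw [lintegral_add_left measurable_const]; simp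

lemma integrable_and_tendsto_integral_of_tendsto_lintegral {Ω : Type*} [MeasurableSpace Ω]
    {P : Measure Ω} {f : ℕ → Ω → ℝ} {a : ℝ} (ha : 0 ≤ a) (hf : ∀ n, Measurable (f n))
    (hf0 : ∀ n ω, 0 ≤ f n ω)
    (h : Tendsto (fun n => ∫⁻ ω, ENNReal.ofReal (f n ω) ∂P) atTop (𝓝 (ENNReal.ofReal a))) :
    (∀ᶠ n in atTop, Integrable (f n) P) ∧ Tendsto (fun n => ∫ ω, f n ω ∂P) atTop (𝓝 a) := by
  constructor
  · filter_upwards [h.eventually_lt_const ENNReal.ofReal_lt_top] with n hn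
    exact ⟨(hf n).aestronglyMeasurable, (hasFiniteIntegral_iff_ofReal (.of_forall (hf0 n))).2 hn⟩
  · have := (ENNReal.tendsto_toReal ENNReal.ofReal_ne_top).comp h
    rw [ENNReal.toReal_ofReal ha] at this
    refine this.congr fun n => ?_
    exact (integral_eq_lintegral_of_nonneg_ae (.of_forall (hf0 n))
      (hf n).aestronglyMeasurable).symm

end WGAN

theorem mainTheorem6
    {d dY dZ D dg : ℕ} (hd : 0 < d) (hdY : 0 < dY) (hdZ : 0 < dZ) (hD : 0 < D) (hdg : 0 < dg)
    {β K γ F c : ℝ} (hβ : 1 ≤ β) (hK : 0 < K) (hγ : 1 ≤ γ) (hF : 1 ≤ F) (hc : 0 < c)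
    -- the random variables `X`, `Y`, `Z`
    {Ω : Type*} [MeasurableSpace Ω] (P : Measure Ω) [IsProbabilityMeasure P]
    (X : Ω → Fin d → ℝ) (Y : Ω → Fin dY → ℝ) (Z : Ω → Fin dZ → ℝ)
    (hX : Measurable X) (hY : Measurable Y) (hZ : Measurable Z)
    (hXcube : ∀ᵐ ω ∂P, X ω ∈ WGAN.unitCube d) (hYcube : ∀ᵐ ω ∂P, Y ω ∈ WGAN.unitCube dY)
    (hZcube : ∀ᵐ ω ∂P, Z ω ∈ WGAN.unitCube dZ)
    (hZY : IndepFun Z Y P)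
    -- the joint law of `(X, Y)` is that of `(g*(Z, Y), Y)`
    (gstar : (Fin (dZ + dY) → ℝ) → (Fin d → ℝ))
    (hgstar : gstar ∈ WGAN.encoderDecoderClass dZ dY d D dg β K)
    (hlaw : P.map (fun ω => (X ω, Y ω)) =
      P.map (fun ω => (gstar (Fin.append (Z ω) (Y ω)), Y ω)))
    -- the critic networks, with `n * a_n = n * n ^ (-(2γ / (2γ + d)))`
    (A : ℕ → WGAN.Architecture (d + dY) 1) (s : ℕ → ℕ)
    (hdepth : ∀ᶠ n : ℕ in atTop,
      Real.logb 2 n * Real.logb 2 (max (4 * (d : ℝ)) (4 * γ)) ≤ (A n).depth)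
    (hwidth : ∀ᶠ n : ℕ in atTop, ∀ i, 1 ≤ i → i ≤ (A n).depth →
      c * (n * (n : ℝ) ^ (-(2 * γ / (2 * γ + d)))) ≤ (A n).width i)
    (hsparse : ∀ᶠ n : ℕ in atTop,
      c * (Real.log n * (n * (n : ℝ) ^ (-(2 * γ / (2 * γ + d))))) ≤ s n)
    (hdepth_sparse : (fun n => ((A n).depth : ℝ)) =o[atTop] (fun n => (s n : ℝ)))
    -- the random generators, measurable with respect to a σ-algebra `𝒯 n` independent of `(Z, Y)`
    (𝒯 : ℕ → MeasurableSpace Ω) (h𝒯 : ∀ n, 𝒯 n ≤ ‹MeasurableSpace Ω›)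
    (h𝒯indep : ∀ n, Indep (𝒯 n)
      (MeasurableSpace.comap (fun ω => (Z ω, Y ω)) inferInstance) P)
    (ghat : ℕ → Ω → (Fin (dZ + dY) → ℝ) → (Fin d → ℝ))
    (hghat : ∀ n, Measurable[(𝒯 n).prod inferInstance]
      (fun q : Ω × (Fin (dZ + dY) → ℝ) => ghat n q.1 q.2))
    (hghat_int : ∀ n, ∀ᵐ ω ∂P,
      Integrable (fun ω' => ghat n ω (Fin.append (Z ω') (Y ω'))) P)
    -- `E W^c_{1,n}(ĝ_n) → 0`
    (hW : Tendsto
      (fun n => ∫⁻ ω, (WGAN.conditionalW P X Y Z (A n) (s n) F (ghat n ω)).toENNReal ∂P)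
      atTop (𝓝 0)) :
    -- `(ĝ_n(Z, Y), Y) → (X, Y)` and `ĝ_n(Z, Y) → X` in distribution
    TendstoInDistribution
      (fun n ω => (ghat n ω (Fin.append (Z ω) (Y ω)), Y ω)) atTop
      (fun ω => (X ω, Y ω)) (fun _ => P) P ∧
    TendstoInDistribution
      (fun n ω => ghat n ω (Fin.append (Z ω) (Y ω))) atTop X (fun _ => P) P ∧
    -- the laws of `ĝ_n(Z, y)` converge to the conditional laws of `X` given `Y = y`,
    -- weakly when integrated against densities in `y`
    ∀ (h : (Fin d → ℝ) →ᵇ ℝ) (φ : (Fin dY → ℝ) → ℝ), Integrable φ (P.map Y) →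
      Tendsto (fun n => ∫ y, φ y * (∫ ω, h (ghat n ω (Fin.append (Z ω) y)) ∂P) ∂(P.map Y))
        atTop (𝓝 (∫ y, φ y * (∫ x, h x ∂(condDistrib X Y P y)) ∂(P.map Y))) := by
  have hghat' : ∀ n, Measurable fun q : Ω × (Fin (dZ + dY) → ℝ) => ghat n q.1 q.2 := fun n =>
    (hghat n).mono (sup_le_sup (MeasurableSpace.comap_mono (h𝒯 n)) le_rfl) le_rfl
  have hghatZY : ∀ n, Measurable fun ω => ghat n ω (Fin.append (Z ω) (Y ω)) := fun n =>
    (hghat' n).comp (measurable_id.prodMk (WGAN.measurable_append.comp (hZ.prodMk hY)))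
  have hcrit := WGAN.eventually_ridge_mem_criticClass hd hγ hF hc A s hdepth hwidth hsparse
    hdepth_sparse
  have hridge : TendstoInDistribution
      (fun n ω => Fin.append (ghat n ω (Fin.append (Z ω) (Y ω))) (Y ω)) atTop
      (fun ω => Fin.append (X ω) (Y ω)) (fun _ => P) P := by
    have hVm : ∀ n, Measurable fun ω => Fin.append (ghat n ω (Fin.append (Z ω) (Y ω))) (Y ω) :=
      fun n => WGAN.measurable_append.comp ((hghatZY n).prodMk hY)
    refine WGAN.tendstoInDistribution_of_ridge hVm (WGAN.measurable_append.comp (hX.prodMk hY))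
      ?_ fun θ v => ?_
    · filter_upwards [hXcube, hYcube] with ω h1 h2 using WGAN.append_mem_unitCube h1 h2
    -- `κ` rescales the ridge function so that it becomes a critic
    set κ : ℝ := (1 + ((∑ i, |θ i|) + |v|))⁻¹ with hκ
    have hκ0 : 0 < κ := by positivity
    have hκ1 : (∑ i, |κ * θ i|) + |κ * v| ≤ 1 := by
      simp_rw [abs_mul, abs_of_pos hκ0]
      rw [← Finset.mul_sum, ← mul_add, hκ, inv_mul_le_iff₀ (by positivity)]
      linarith
    have hlim := WGAN.integrable_and_tendsto_integral_of_tendsto_lintegral (P := P)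
      (integral_nonneg fun _ => WGAN.ridge_nonneg _ _ _)
      (fun n => (WGAN.continuous_ridge _ _).measurable.comp (hVm n))
      (fun _ _ => WGAN.ridge_nonneg _ _ _)
      (WGAN.tendsto_lintegral_critic P X Y Z hY hZ A s 𝒯 h𝒯 h𝒯indep ghat hghat hW
        (f := WGAN.ridge (fun i => κ * θ i) (κ * v)) (WGAN.ridge_nonneg _ _)
        (WGAN.continuous_ridge _ _) (fun n => ?_) ?_)
    · simp only [WGAN.ridge_smul hκ0.le, integral_const_mul, Function.comp_def,
        integrable_const_mul_iff (IsUnit.mk0 _ hκ0.ne')] at hlim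
      refine ⟨hlim.1, ?_⟩
      simpa [hκ0.ne'] using hlim.2.const_mul κ⁻¹
    · filter_upwards [hghat_int n] with ω hω
      refine WGAN.integrable_ridge_comp _ _ fun i => ?_
      cases i using Fin.addCases with
      | left i => simpa using (integrable_pi_iff.1 hω) i
      | right i =>
        simp only [Fin.append_right]
        refine Integrable.of_bound (by fun_prop) 1 ?_
        filter_upwards [hYcube] with ω' h
        rw [Real.norm_eq_abs, abs_of_nonneg (h.1 i)]
        exact h.2 i
    · filter_upwards [hcrit] with n hn
      exact ⟨by simpa using hn _ _ hκ1 1 (by simp), by simpa using hn _ _ hκ1 (-1) (by simp)⟩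
  have hjoint : TendstoInDistribution
      (fun n ω => (ghat n ω (Fin.append (Z ω) (Y ω)), Y ω)) atTop
      (fun ω => (X ω, Y ω)) (fun _ => P) P := by
    have h := hridge.continuous_comp (Fin.appendHomeomorph (X := ℝ) d dY).symm.continuous
    have hsymm : ∀ (x : Fin d → ℝ) (y : Fin dY → ℝ),
        (Fin.appendHomeomorph (X := ℝ) d dY).symm (Fin.append x y) = (x, y) := fun x y =>
      (Fin.appendHomeomorph (X := ℝ) d dY).symm_apply_apply (x, y)
    simpa only [Function.comp_def, hsymm] using h
  -- both sides of the last claim are rewritten as expectations on `Ω`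
  refine ⟨hjoint, hjoint.continuous_comp continuous_fst, fun h φ hφ => ?_⟩
  have hh : ∀ x, ‖h x‖ ≤ ‖h‖ := h.norm_coe_le_norm
  rw [WGAN.integral_mul_condDistrib hX hY h.continuous.measurable hh hφ]
  refine (WGAN.tendsto_integral_mul_of_tendstoInDistribution hY hghatZY hX hjoint h φ hφ).congr
    fun n => ?_
  -- `ω ↦ ω`, as a map to `Ω` with the σ-algebra `𝒯 n`, is the random input independent of `(Z, Y)`
  have hid : @Measurable Ω Ω _ (𝒯 n) id := measurable_id'' (h𝒯 n)
  have hind : @IndepFun Ω Ω _ _ (𝒯 n) _ id (fun ω => (Z ω, Y ω)) P :=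
    WGAN.indepFun_id_of_indep (h𝒯indep n)
  have hk : @Measurable _ _ (((𝒯 n).prod inferInstance).prod inferInstance) _
      (fun q : (Ω × (Fin dZ → ℝ)) × (Fin dY → ℝ) => h (ghat n q.1.1 (Fin.append q.1.2 q.2))) := by
    let _ : MeasurableSpace Ω := 𝒯 n
    exact h.continuous.measurable.comp ((hghat n).comp
      ((measurable_fst.comp measurable_fst).prodMk (WGAN.measurable_append.comp
        ((measurable_snd.comp measurable_fst).prodMk measurable_snd))))
  exact (@WGAN.integral_comp_of_indepFun Ω (Ω × (Fin dZ → ℝ)) _ _ ((𝒯 n).prod inferInstance) _ P _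
    (fun ω => (ω, Z ω)) Y (hid.prodMk hZ) hY
    (@WGAN.indepFun_prodMk_of_indepFun Ω Ω _ _ _ (𝒯 n) _ _ P _ id Z Y hid hZ hY hind hZY)
    _ φ hk ‖h‖ (fun _ => hh _) hφ).symm
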